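/- An open set $\Omega\subseteq\mathbb C$ (not necessarily connected) is called simply connected if $(\mathbb C\cup\{\infty\})\setminus\Omega$ is connected. For an open set $\Omega\subseteq\mathbb C$ let $\Omega\cup\{\alpha\}$ denote its one-point compactification. A relatively closed subset $F$ of $\Omega$ is called an Arakelian set in $\Omega$ if $(\Omega\cup\{\alpha\})\setminus F$ is connected and is locally connected at $\alpha$. (a) If $\Omega\subseteq\mathbb C$ is a simply connected open set and $F_1,F_2$ are disjoint Arakelian sets in $\Omega$, then $F_1\cup F_2$ is an Arakelian set in $\Omega$. (b) Simple connectivity cannot be dropped: the set $\Omega=\{z\in\mathbb C: 0<|z|<1\}$ is open and not simply connected, and for all $0<r_1<r_2<1$ the circles $F_j=\{z\in\mathbb C:|z|=r_j\}$, $j=1,2$, are disjoint Arakelian sets in $\Omega$ whose union $F_1\cup F_2$ is not Arakelian in $\Omega$. -/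

import Mathlib

open Topology

/-- A (not necessarily connected) planar open set `Ω` is simply connected when its complement
`(ℂ ∪ {∞}) \ Ω` in the Riemann sphere is connected. The empty set and disjoint unions of
simply connected domains are included; openness is required separately. -/
def HasConnectedSphereCompl (Ω : Set ℂ) : Prop :=
  IsConnected (((↑) '' Ω : Set (OnePoint ℂ))ᶜ)

/-- For `F ⊆ Ω`, the set `(Ω ∪ {α}) \ F`, where `Ω ∪ {α}` is the one-point compactification
of `Ω` (with the topology of `Ω` as a subspace of `ℂ`). -/
def onePointCompl (Ω F : Set ℂ) : Set (OnePoint Ω) :=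
  ((↑) '' ((↑) ⁻¹' F : Set Ω))ᶜ

/-- The subspace `S` is locally connected at its point `x`: every neighbourhood of `x` in `S`
contains a connected (relatively) open neighbourhood of `x` in `S`. -/
def IsLocallyConnectedWithinAt {X : Type*} [TopologicalSpace X] (S : Set X) (x : X) : Prop :=
  ∀ U : Set X, IsOpen U → x ∈ U →
    ∃ W : Set X, IsOpen W ∧ x ∈ W ∧ W ⊆ U ∧ IsConnected (W ∩ S)

/-- `F` is an Arakelian set in the open set `Ω`: it is a relatively closed subset of `Ω` such that
`(Ω ∪ {α}) \ F` is connected, and locally connected at `α`. -/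
structure IsArakelian (Ω F : Set ℂ) : Prop where
  subset : F ⊆ Ω
  isClosed : IsClosed ((↑) ⁻¹' F : Set Ω)
  isConnected : IsConnected (onePointCompl Ω F)
  locallyConnectedAt :
    IsLocallyConnectedWithinAt (onePointCompl Ω F) (OnePoint.infty : OnePoint Ω)

/-! Both topological conditions at `α` become statements about components. Connectedness says that
no component of `Ω \ F` is relatively compact in `Ω`. Local connectedness says that, for each
compact `K`, the components of `Ω \ (F ∪ K)` trapped in a compact set all lie in one compact set.

Part (a) then follows from a Janiszewski-type argument with continuous logarithms (`Escapes.union`).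
Suppose the component `C` of `p` off `F₁ ∪ F₂ ∪ K` is relatively compact. Since `p` escapes off each
`Fⱼ ∪ K`, simple connectivity gives a logarithm of `z - p` on the part of `Fⱼ ∪ K` in `closure C`
(`Escapes.hasLogSub`). As `F₁` and `F₂` are disjoint, these meet only in `K`, where they differ by a
constant once `K` is suitably enlarged. Glued, they give a logarithm on the boundary of `C`,
contradicting `not_hasLogSub_frontier`.

In (b) the annulus between the circles is trapped, while a single circle lets every point escape
radially. -/

lemma infty_mem_compl_image_coe {X : Type*} (s : Set X) :
    OnePoint.infty ∈ ((↑) '' s : Set (OnePoint X))ᶜ :=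
  OnePoint.infty_notMem_image_coe

/-! ### Escaping components and connectedness at infinity -/

/-- The component of `p` in `U` is not contained in any compact set. -/
def Escapes {X : Type*} [TopologicalSpace X] (U : Set X) (p : X) : Prop :=
  ∀ Q : Set X, IsCompact Q → ¬ connectedComponentIn U p ⊆ Q

section Escapes

variable {X : Type*} [TopologicalSpace X] {U V : Set X} {p : X}

lemma Escapes.mono (h : Escapes U p) (hUV : U ⊆ V) : Escapes V p :=
  fun Q hQ hC => h Q hQ ((connectedComponentIn_mono p hUV).trans hC)

lemma Escapes.of_mem (h : Escapes U p) {q : X} (hq : q ∈ connectedComponentIn U p) :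
    Escapes U q := by
  rwa [Escapes, ← connectedComponentIn_eq hq]

lemma mem_connectedComponentIn_of_mem_closure [LocallyConnectedSpace X] (hU : IsOpen U) {q : X}
    (hq : q ∈ U) (h : q ∈ closure (connectedComponentIn U p)) :
    q ∈ connectedComponentIn U p := by
  obtain ⟨z, hzq, hzp⟩ := mem_closure_iff.1 h _ (hU.connectedComponentIn (x := q))
    (mem_connectedComponentIn hq)
  rw [connectedComponentIn_eq hzp, ← connectedComponentIn_eq hzq]
  exact mem_connectedComponentIn hq

/-- A component with compact closure would be relatively clopen in `T`, separating `p` from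
infinity. -/
lemma escapes_of_isPreconnected [T2Space X] [LocallyConnectedSpace X] (hU : IsOpen U)
    {T : Set (OnePoint X)} (hT : IsPreconnected T) (hinf : OnePoint.infty ∈ T)
    (hTU : ∀ x : X, (x : OnePoint X) ∈ T → x ∈ U) (hp : (p : OnePoint X) ∈ T) :
    Escapes U p := by
  intro Q hQ hC
  have hcl : IsCompact (closure (connectedComponentIn U p)) :=
    hQ.of_isClosed_subset isClosed_closure (closure_minimal hC hQ.isClosed)
  obtain ⟨x, -, hxu, hxv⟩ := hT ((↑) '' connectedComponentIn U p)
    ((↑) '' closure (connectedComponentIn U p))ᶜ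
    (OnePoint.isOpen_image_coe.2 hU.connectedComponentIn)
    (OnePoint.isOpen_compl_image_coe.2 ⟨isClosed_closure, hcl⟩)
    (by
      intro x hx
      induction x using OnePoint.rec with
      | infty => exact Or.inr OnePoint.infty_notMem_image_coe
      | coe y =>
        by_cases hy : y ∈ closure (connectedComponentIn U p)
        · exact Or.inl ⟨y, mem_connectedComponentIn_of_mem_closure hU (hTU y hx) hy, rfl⟩
        · right
          rintro ⟨z, hz, hzy⟩
          exact hy (OnePoint.coe_injective hzy ▸ hz))
    ⟨p, hp, p, mem_connectedComponentIn (hTU p hp), rfl⟩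
    ⟨OnePoint.infty, hinf, infty_mem_compl_image_coe _⟩
  exact hxv (Set.image_mono subset_closure hxu)

lemma Escapes.infty_mem_closure (h : Escapes U p) :
    OnePoint.infty ∈ closure ((↑) '' connectedComponentIn U p : Set (OnePoint X)) := by
  rw [mem_closure_iff]
  intro o ho hinf
  by_contra hne
  refine h _ ((OnePoint.isOpen_iff_of_mem hinf).1 ho).2 fun x hx hxo => hne ⟨x, hxo, x, hx, rfl⟩

/-- Each escaping component has infinity in its closure, so all of them are tied together at that
point. -/
lemma isConnected_insert_infty_escapes :
    IsConnected (insert OnePoint.infty ((↑) '' {q | q ∈ U ∧ Escapes U q}) : Set (OnePoint X)) := by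
  refine ⟨⟨_, Set.mem_insert _ _⟩, isPreconnected_of_forall OnePoint.infty ?_⟩
  rintro y (rfl | ⟨q, ⟨hqU, hq⟩, rfl⟩)
  · exact ⟨{OnePoint.infty}, by simp, rfl, rfl, isPreconnected_singleton⟩
  · refine ⟨insert OnePoint.infty ((↑) '' connectedComponentIn U q), ?_, Set.mem_insert _ _,
      Or.inr ⟨q, mem_connectedComponentIn hqU, rfl⟩, ?_⟩
    · exact Set.insert_subset_insert (Set.image_mono fun z hz =>
        ⟨connectedComponentIn_subset _ _ hz, hq.of_mem hz⟩)
    · exact (isPreconnected_connectedComponentIn.image _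
        OnePoint.continuous_coe.continuousOn).subset_closure (Set.subset_insert _ _)
        (Set.insert_subset hq.infty_mem_closure subset_closure)

lemma isConnected_compl_image_coe_iff [T2Space X] [LocallyConnectedSpace X] {F : Set X}
    (hF : IsClosed F) :
    IsConnected (((↑) '' F : Set (OnePoint X))ᶜ) ↔ ∀ p ∉ F, Escapes Fᶜ p := by
  constructor
  · intro h p hp
    refine escapes_of_isPreconnected hF.isOpen_compl h.isPreconnected
      (infty_mem_compl_image_coe _) ?_ ?_
    · simp
    · simpa using hp
  · intro h
    convert isConnected_insert_infty_escapes (U := Fᶜ) using 1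
    rw [OnePoint.compl_image_coe, Set.union_singleton]
    congr 2
    ext q
    simpa using h q

lemma isLocallyConnectedWithinAt_infty_iff [T2Space X] [LocallyConnectedSpace X] {F : Set X}
    (hF : IsClosed F) :
    IsLocallyConnectedWithinAt (((↑) '' F : Set (OnePoint X))ᶜ) OnePoint.infty ↔
      ∀ K, IsCompact K → ∃ Q, IsCompact Q ∧ ∀ p ∉ F ∪ K ∪ Q, Escapes (F ∪ K)ᶜ p := by
  constructor
  · intro h K hK
    obtain ⟨W, hW, hinf, hWK, hconn⟩ := h ((↑) '' K)ᶜ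
      (OnePoint.isOpen_compl_image_coe.2 ⟨hK.isClosed, hK⟩) (infty_mem_compl_image_coe _)
    refine ⟨((↑) ⁻¹' W)ᶜ, ((OnePoint.isOpen_iff_of_mem hinf).1 hW).2, fun p hp => ?_⟩
    simp only [Set.mem_union, Set.mem_compl_iff, Set.mem_preimage, not_or, not_not] at hp
    refine escapes_of_isPreconnected (hF.union hK.isClosed).isOpen_compl hconn.isPreconnected
      ⟨hinf, OnePoint.infty_notMem_image_coe⟩ ?_ ⟨hp.2, by simpa using hp.1.1⟩
    rintro x ⟨hxW, hxF⟩ (hx | hx)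
    · exact hxF ⟨x, hx, rfl⟩
    · exact hWK hxW ⟨x, hx, rfl⟩
  · intro h U hU hinf
    obtain ⟨-, hK⟩ := (OnePoint.isOpen_iff_of_mem hinf).1 hU
    set K : Set X := ((↑) ⁻¹' U)ᶜ with hKdef
    obtain ⟨Q, hQ, hesc⟩ := h K hK
    -- `H` is the union of the trapped components. Deleting `closure (K ∪ H)` leaves a neighbourhood
    -- of infinity that, off `F`, consists of infinity and the escaping components.
    set H : Set X := {q | q ∈ (F ∪ K)ᶜ ∧ ¬ Escapes (F ∪ K)ᶜ q} with hH
    have hopen : IsOpen (F ∪ K)ᶜ := (hF.union hK.isClosed).isOpen_compl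
    have hHQ : H ⊆ Q := by
      rintro q ⟨hq, hqe⟩
      by_contra hqQ
      exact hqe (hesc q (by simp_all))
    have hcomp : IsCompact (closure (K ∪ H)) :=
      (hK.union hQ).of_isClosed_subset isClosed_closure
        (closure_minimal (Set.union_subset_union_right _ hHQ) (hK.union hQ).isClosed)
    -- Components are open, so taking the closure adds only points of `F`.
    have hcl : ∀ q ∈ closure (K ∪ H), q ∉ F → q ∈ K ∪ H := by
      intro q hq hqF
      by_cases hqK : q ∈ K
      · exact Or.inl hqK
      have hqU : q ∈ (F ∪ K)ᶜ := by simp [hqF, hqK]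
      obtain ⟨z, hzq, hz⟩ := mem_closure_iff.1 hq _ (hopen.connectedComponentIn (x := q))
        (mem_connectedComponentIn hqU)
      have hzU := connectedComponentIn_subset _ _ hzq
      rcases hz with hz | hz
      · exact absurd (Or.inr hz) hzU
      · exact Or.inr ⟨hqU, fun he => hz.2 (he.of_mem hzq)⟩
    refine ⟨((↑) '' closure (K ∪ H))ᶜ, OnePoint.isOpen_compl_image_coe.2 ⟨isClosed_closure, hcomp⟩,
      infty_mem_compl_image_coe _, ?_, ?_⟩
    · intro x hx
      induction x using OnePoint.rec with
      | infty => exact hinf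
      | coe y =>
        by_contra hy
        exact hx ⟨y, subset_closure (Or.inl hy), rfl⟩
    · convert isConnected_insert_infty_escapes (U := (F ∪ K)ᶜ) using 1
      ext x
      induction x using OnePoint.rec with
      | infty => simp
      | coe y =>
        have h1 : (y : OnePoint X) ∈ ((↑) '' closure (K ∪ H) : Set (OnePoint X))ᶜ ↔
            y ∉ closure (K ∪ H) := by simp
        have h2 : (y : OnePoint X) ∈ ((↑) '' F : Set (OnePoint X))ᶜ ↔ y ∉ F := by simp
        have h3 : (y : OnePoint X) ∈ insert OnePoint.infty
            ((↑) '' {q | q ∈ (F ∪ K)ᶜ ∧ Escapes (F ∪ K)ᶜ q} : Set (OnePoint X)) ↔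
            y ∈ (F ∪ K)ᶜ ∧ Escapes (F ∪ K)ᶜ y := by simp
        rw [Set.mem_inter_iff, h1, h2, h3]
        constructor
        · rintro ⟨hy, hyF⟩
          have hyK : y ∉ K := fun hk => hy (subset_closure (Or.inl hk))
          have hyU : y ∈ (F ∪ K)ᶜ := by simp [hyF, hyK]
          refine ⟨hyU, ?_⟩
          by_contra he
          exact hy (subset_closure (Or.inr ⟨hyU, he⟩))
        · rintro ⟨hyU, he⟩
          have hyF : y ∉ F := fun hf => hyU (Or.inl hf)
          refine ⟨fun hy => ?_, hyF⟩
          rcases hcl y hy hyF with hk | hk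
          · exact hyU (Or.inr hk)
          · exact hk.2 he

end Escapes

lemma isArakelian_iff {Ω F : Set ℂ} (hΩ : IsOpen Ω) :
    IsArakelian Ω F ↔ F ⊆ Ω ∧ IsClosed ((↑) ⁻¹' F : Set Ω) ∧
      (∀ p ∉ ((↑) ⁻¹' F : Set Ω), Escapes ((↑) ⁻¹' F : Set Ω)ᶜ p) ∧
      ∀ K : Set Ω, IsCompact K → ∃ Q, IsCompact Q ∧
        ∀ p ∉ (↑) ⁻¹' F ∪ K ∪ Q, Escapes ((↑) ⁻¹' F ∪ K)ᶜ p := by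
  have : LocallyConnectedSpace Ω := hΩ.locallyConnectedSpace
  constructor
  · rintro ⟨h1, h2, h3, h4⟩
    exact ⟨h1, h2, (isConnected_compl_image_coe_iff h2).1 h3,
      (isLocallyConnectedWithinAt_infty_iff h2).1 h4⟩
  · rintro ⟨h1, h2, h3, h4⟩
    exact ⟨h1, h2, (isConnected_compl_image_coe_iff h2).2 h3,
      (isLocallyConnectedWithinAt_infty_iff h2).2 h4⟩

/-! ### Continuous logarithms of `z - p` -/

/-- The function `z ↦ z - p` has a continuous logarithm on `A`. -/
def HasLogSub (A : Set ℂ) (p : ℂ) : Prop :=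
  ∃ g : ℂ → ℂ, ContinuousOn g A ∧ ∀ z ∈ A, Complex.exp (g z) = z - p

lemma HasLogSub.mono {A B : Set ℂ} {p : ℂ} (h : HasLogSub B p) (hAB : A ⊆ B) : HasLogSub A p :=
  let ⟨g, hg, he⟩ := h
  ⟨g, hg.mono hAB, fun z hz => he z (hAB hz)⟩

/-- The quotient `(z - p) / (z - q)` stays within distance 1 of 1, so its principal logarithm
converts one logarithm into the other. -/
lemma hasLogSub_iff_of_dist_lt {A : Set ℂ} {p q : ℂ} (h : ∀ z ∈ A, dist p q < dist z q) :
    HasLogSub A p ↔ HasLogSub A q := by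
  have hne : ∀ z ∈ A, z - q ≠ 0 := fun z hz h0 => by
    have := h z hz
    rw [sub_eq_zero.1 h0, dist_self] at this
    exact absurd this (not_lt.2 dist_nonneg)
  have hslit : ∀ z ∈ A, (z - p) / (z - q) ∈ Complex.slitPlane := by
    intro z hz
    have h1 : (z - p) / (z - q) = 1 + (q - p) / (z - q) := by
      field_simp [hne z hz]
      ring
    rw [h1]
    apply Complex.mem_slitPlane_of_norm_lt_one
    rw [norm_div, div_lt_one (norm_pos_iff.2 (hne z hz)), ← dist_eq_norm, ← dist_eq_norm, dist_comm]
    exact h z hz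
  have hcont : ContinuousOn (fun z => Complex.log ((z - p) / (z - q))) A := by
    apply ContinuousOn.clog _ hslit
    exact ContinuousOn.div (by fun_prop) (by fun_prop) hne
  have hexp : ∀ z ∈ A, Complex.exp (Complex.log ((z - p) / (z - q))) = (z - p) / (z - q) :=
    fun z hz => Complex.exp_log (Complex.slitPlane_ne_zero (hslit z hz))
  constructor
  · rintro ⟨g, hg, he⟩
    refine ⟨_, hg.sub hcont, fun z hz => ?_⟩
    have hzp : z - p ≠ 0 := he z hz ▸ Complex.exp_ne_zero _
    simp only [Pi.sub_apply]
    rw [Complex.exp_sub, he z hz, hexp z hz]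
    field_simp
  · rintro ⟨g, hg, he⟩
    refine ⟨_, hg.add hcont, fun z hz => ?_⟩
    have hzq := hne z hz
    simp only [Pi.add_apply]
    rw [Complex.exp_add, he z hz, hexp z hz]
    field_simp

lemma exists_pos_forall_le_dist {A : Set ℂ} (hA : IsClosed A) {p : ℂ} (hp : p ∉ A) :
    ∃ ε > 0, ∀ z ∈ A, ε ≤ dist z p := by
  obtain ⟨ε, hε, h⟩ := Metric.isOpen_iff.1 hA.isOpen_compl p hp
  exact ⟨ε, hε, fun z hz => not_lt.1 fun hlt => h hlt hz⟩

/-- Taking `P` true or false shows that having and lacking a logarithm are both open conditions off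
`A`. -/
lemma isOpen_setOf_hasLogSub_iff {A : Set ℂ} (hA : IsClosed A) (P : Prop) :
    IsOpen {p | p ∉ A ∧ (HasLogSub A p ↔ P)} := by
  rw [Metric.isOpen_iff]
  rintro p ⟨hp, hP⟩
  obtain ⟨ε, hε, h⟩ := exists_pos_forall_le_dist hA hp
  refine ⟨ε, hε, fun q hq => ⟨fun hqA => absurd (h q hqA) (not_le.2 hq), ?_⟩⟩
  rw [← hP]
  exact hasLogSub_iff_of_dist_lt fun z hz => lt_of_lt_of_le hq (h z hz)

lemma isOpen_setOf_hasLogSub {A : Set ℂ} (hA : IsClosed A) :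
    IsOpen {p | p ∉ A ∧ HasLogSub A p} := by
  simpa using isOpen_setOf_hasLogSub_iff hA True

lemma isOpen_setOf_not_hasLogSub {A : Set ℂ} (hA : IsClosed A) :
    IsOpen {p | p ∉ A ∧ ¬ HasLogSub A p} := by
  simpa using isOpen_setOf_hasLogSub_iff hA False

lemma HasLogSub.of_isPreconnected {A T : Set ℂ} (hA : IsClosed A) (hT : IsPreconnected T)
    (hTA : T ⊆ Aᶜ) {p q : ℂ} (hp : p ∈ T) (hq : q ∈ T) (h : HasLogSub A q) : HasLogSub A p := by
  by_contra hn
  obtain ⟨x, -, h1, h2⟩ := hT _ _ (isOpen_setOf_hasLogSub hA) (isOpen_setOf_not_hasLogSub hA)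
    (fun x hx => (em (HasLogSub A x)).imp (⟨hTA hx, ·⟩) (⟨hTA hx, ·⟩))
    ⟨q, hq, hTA hq, h⟩ ⟨p, hp, hTA hp, hn⟩
  exact h2.2 h1.2

lemma HasLogSub.of_norm_lt {A : Set ℂ} {p : ℂ} (h : ∀ z ∈ A, ‖z‖ < ‖p‖) : HasLogSub A p := by
  rcases A.eq_empty_or_nonempty with rfl | ⟨z₀, hz₀⟩
  · exact ⟨0, by simp, by simp⟩
  have hp : p ≠ 0 := norm_pos_iff.1 ((norm_nonneg _).trans_lt (h z₀ hz₀))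
  have hs : ∀ z ∈ A, 1 + -(z / p) ∈ Complex.slitPlane := by
    intro z hz
    apply Complex.mem_slitPlane_of_norm_lt_one
    rw [norm_neg, norm_div, div_lt_one (norm_pos_iff.2 hp)]
    exact h z hz
  refine ⟨fun z => Complex.log (1 + -(z / p)) + Complex.log (-p),
    ContinuousOn.add (ContinuousOn.clog (by fun_prop) hs) continuousOn_const, fun z hz => ?_⟩
  rw [Complex.exp_add, Complex.exp_log (Complex.slitPlane_ne_zero (hs z hz)),
    Complex.exp_log (neg_ne_zero.2 hp)]
  field_simp
  ring

/-- Points off a compact set `A`, at which `z ↦ z - p` has no logarithm on `A`, stay away from the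
complement of `Ω ⊇ A` when that complement is connected in the sphere. -/
lemma isCompact_setOf_not_hasLogSub {Ω A : Set ℂ} (hΩ : HasConnectedSphereCompl Ω)
    (hA : IsCompact A) (hAΩ : A ⊆ Ω) :
    IsCompact (A ∪ {p | p ∉ A ∧ ¬ HasLogSub A p}) ∧ A ∪ {p | p ∉ A ∧ ¬ HasLogSub A p} ⊆ Ω := by
  have hcompl : A ∪ {p | p ∉ A ∧ ¬ HasLogSub A p} = {p | p ∉ A ∧ HasLogSub A p}ᶜ := by
    ext p
    simp only [Set.mem_union, Set.mem_ofPred_eq, Set.mem_compl_iff]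
    tauto
  have hcl : IsClosed (A ∪ {p | p ∉ A ∧ ¬ HasLogSub A p}) :=
    hcompl ▸ (isOpen_setOf_hasLogSub hA.isClosed).isClosed_compl
  have hcomp : IsCompact (A ∪ {p | p ∉ A ∧ ¬ HasLogSub A p}) := by
    refine Metric.isCompact_of_isClosed_isBounded hcl ?_
    obtain ⟨R, hR⟩ := hA.isBounded.exists_norm_le
    refine (Metric.isBounded_closedBall (x := (0 : ℂ)) (r := R)).subset ?_
    rintro p (hp | ⟨-, hp⟩)
    · simpa using hR p hp
    · rw [mem_closedBall_zero_iff]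
      by_contra! hlt
      exact hp (HasLogSub.of_norm_lt fun z hz => (hR z hz).trans_lt hlt)
  refine ⟨hcomp, ?_⟩
  by_contra hsub
  obtain ⟨p, hp, hpΩ⟩ := Set.not_subset.1 hsub
  have hpA : p ∉ A := fun h => hpΩ (hAΩ h)
  have hp' : ¬ HasLogSub A p := (hp.resolve_left hpA).2
  -- As `A` misses the complement of `Ω`, the points without logarithm would split off a clopen
  -- piece of that complement not containing infinity.
  obtain ⟨x, -, hx1, hx2⟩ := hΩ.isPreconnected
    ((↑) '' (A ∪ {p | p ∉ A ∧ ¬ HasLogSub A p}))ᶜ ((↑) '' {p | p ∉ A ∧ ¬ HasLogSub A p})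
    (OnePoint.isOpen_compl_image_coe.2 ⟨hcl, hcomp⟩)
    (OnePoint.isOpen_image_coe.2 (isOpen_setOf_not_hasLogSub hA.isClosed))
    (by
      intro x hx
      by_contra hn
      rw [Set.mem_union, not_or, Set.mem_compl_iff, not_not] at hn
      obtain ⟨⟨z, hz | hz, rfl⟩, hn2⟩ := hn
      · exact hx ⟨z, hAΩ hz, rfl⟩
      · exact hn2 ⟨z, hz, rfl⟩)
    ⟨OnePoint.infty, infty_mem_compl_image_coe _, infty_mem_compl_image_coe _⟩
    ⟨p, by simpa using hpΩ, p, ⟨hpA, hp'⟩, rfl⟩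
  exact hx1 (Set.image_mono Set.subset_union_right hx2)

/-- The values lie in the discrete set of integer multiples of `2πi`. -/
lemma eq_of_isPreconnected_of_exp_eq_one {X : Type*} [TopologicalSpace X] {T : Set X}
    (hT : IsPreconnected T) {h : X → ℂ} (hc : ContinuousOn h T)
    (he : ∀ t ∈ T, Complex.exp (h t) = 1) {s t : X} (hs : s ∈ T) (ht : t ∈ T) : h s = h t := by
  have hI : (2 * Real.pi * Complex.I : ℂ) ≠ 0 := Complex.two_pi_I_ne_zero
  set u : X → ℝ := fun t => (h t / (2 * Real.pi * Complex.I)).re with hu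
  have huc : ContinuousOn u T :=
    Complex.continuous_re.comp_continuousOn (hc.div_const _)
  have hun : ∀ t ∈ T, ∃ n : ℤ, u t = n ∧ h t = n * (2 * Real.pi * Complex.I) := by
    intro t ht
    obtain ⟨n, hn⟩ := Complex.exp_eq_one_iff.1 (he t ht)
    refine ⟨n, ?_, hn⟩
    simp only [hu]
    rw [hn, mul_div_assoc, div_self hI]
    simp
  have hrange : (u '' T) ⊆ Set.range ((↑) : ℤ → ℝ) := by
    rintro _ ⟨t, ht, rfl⟩
    obtain ⟨n, hn, -⟩ := hun t ht
    exact ⟨n, hn.symm⟩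
  have hsub : (u '' T).Subsingleton :=
    (Set.countable_range _).isTotallyDisconnected _ hrange (hT.image u huc)
  obtain ⟨n, hn, hn'⟩ := hun s hs
  obtain ⟨m, hm, hm'⟩ := hun t ht
  have : (n : ℝ) = m := by rw [← hn, ← hm]; exact hsub ⟨s, hs, rfl⟩ ⟨t, ht, rfl⟩
  rw [hn', hm', Int.cast_injective this]

/-- `z ↦ z - p` has no continuous logarithm on a circle around `p`. -/
lemma not_hasLogSub_sphere (p : ℂ) {R : ℝ} (hR : 0 < R) : ¬ HasLogSub (Metric.sphere p R) p := by
  rintro ⟨g, hg, he⟩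
  have hmem : ∀ t : ℝ, circleMap p R t ∈ Metric.sphere p R := circleMap_mem_sphere p hR.le
  have hc : ContinuousOn (fun t : ℝ => g (circleMap p R t) - (t * Complex.I + Real.log R))
      Set.univ := by
    apply ContinuousOn.sub
    · exact hg.comp (continuous_circleMap p R).continuousOn fun t _ => hmem t
    · fun_prop
  have h1 : ∀ t ∈ Set.univ (α := ℝ),
      Complex.exp (g (circleMap p R t) - (t * Complex.I + Real.log R)) = 1 := by
    intro t _
    rw [Complex.exp_sub, he _ (hmem t), Complex.exp_add, ← Complex.ofReal_exp, Real.exp_log hR,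
      circleMap_sub_center, circleMap_zero, mul_comm]
    exact div_self (mul_ne_zero (Complex.exp_ne_zero _) (by exact_mod_cast hR.ne'))
  have := eq_of_isPreconnected_of_exp_eq_one isPreconnected_univ hc h1
    (Set.mem_univ 0) (Set.mem_univ (2 * Real.pi))
  have hper : circleMap p R (2 * Real.pi) = circleMap p R 0 := by
    simpa using periodic_circleMap p R 0
  rw [hper] at this
  have h2 : (2 * Real.pi * Complex.I : ℂ) = 0 := by
    push_cast at this
    linear_combination this
  exact Complex.two_pi_I_ne_zero h2

/-- `z ↦ z - p` has no continuous logarithm on the boundary of a bounded set containing `p`. -/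
lemma not_hasLogSub_frontier {C : Set ℂ} (hb : Bornology.IsBounded C) {p : ℂ}
    (hp : p ∈ C) : ¬ HasLogSub (frontier C) p := by
  classical
  rintro ⟨g, hg, he⟩
  -- Tietze: extend the logarithm to the plane, then replace `z - p` on `C` by the zero-free `exp
  -- G`.
  obtain ⟨G, hG⟩ := ContinuousMap.exists_restrict_eq (isClosed_frontier (s := C))
    ⟨(frontier C).domRestrict g, continuousOn_iff_continuous_domRestrict.1 hg⟩
  have hGg : ∀ z ∈ frontier C, G z = g z := fun z hz => by
    simpa using congr($hG ⟨z, hz⟩)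
  set f : ℂ → ℂ := fun z => if z ∈ C then Complex.exp (G z) else z - p with hf
  have hfc : Continuous f := by
    refine continuous_if (fun z hz => ?_) (by fun_prop) (by fun_prop)
    rw [hGg z hz, he z hz]
  have hf0 : ∀ z, f z ≠ 0 := by
    intro z
    by_cases hz : z ∈ C
    · simp [hf, hz]
    · simp only [hf, hz, if_false]
      exact fun h0 => hz (sub_eq_zero.1 h0 ▸ hp)
  -- The zero-free `f` lifts through `exp`; on a large circle outside `C` the lift is a logarithm of
  -- `z - p`.
  obtain ⟨L, ⟨-, hL⟩, -⟩ := Complex.isCoveringMapOn_exp.existsUnique_continuousMap_lifts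
    ⟨f, hfc⟩ (a₀ := p) (Complex.exp_log (hf0 p)) hf0
  obtain ⟨R, hR⟩ := hb.subset_ball p
  have hR0 : 0 < R := Metric.pos_of_mem_ball (hR hp)
  refine not_hasLogSub_sphere p hR0 ⟨L, by fun_prop, fun z hz => ?_⟩
  have hzC : z ∉ C := fun h => (Metric.mem_ball.1 (hR h)).ne hz
  have := congr_fun hL z
  simpa [hf, hzC] using this

/-- A compact subset of a planar open set can be enlarged so that points joined in the open set
are joined in the compact set. -/
lemma exists_isCompact_joinedIn {Ω K : Set ℂ} (hΩ : IsOpen Ω) (hK : IsCompact K) (hKΩ : K ⊆ Ω) :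
    ∃ L, IsCompact L ∧ K ⊆ L ∧ L ⊆ Ω ∧ ∀ x ∈ L, ∀ y ∈ L, JoinedIn Ω x y → JoinedIn L x y := by
  have hball : ∀ x : ℂ, ∃ r > 0, x ∈ Ω → Metric.closedBall x r ⊆ Ω := by
    intro x
    by_cases hx : x ∈ Ω
    · obtain ⟨r, hr, h⟩ := Metric.nhds_basis_closedBall.mem_iff.1 (hΩ.mem_nhds hx)
      exact ⟨r, hr, fun _ => h⟩
    · exact ⟨1, one_pos, fun h => absurd h hx⟩
  choose r hr hrΩ using hball
  have : PathConnectedSpace unitInterval := isPathConnected_iff_pathConnectedSpace.1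
    ((convex_Icc (0 : ℝ) 1).isPathConnected ⟨0, by simp⟩)
  have hpath : ∀ a b : ℂ, ∃ P, IsCompact P ∧ P ⊆ Ω ∧
      (∀ x ∈ P, JoinedIn P a x) ∧ (JoinedIn Ω a b → a ∈ P ∧ b ∈ P) := by
    intro a b
    by_cases h : JoinedIn Ω a b
    · have h0 : a ∈ Set.range h.somePath := ⟨0, h.somePath.source⟩
      refine ⟨Set.range h.somePath, isCompact_range h.somePath.continuous, ?_, ?_, fun _ => ⟨h0, ?_⟩⟩
      · rintro _ ⟨t, rfl⟩
        exact h.somePath_mem t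
      · exact fun x hx => (isPathConnected_range h.somePath.continuous).joinedIn a h0 x hx
      · exact ⟨1, h.somePath.target⟩
    · exact ⟨∅, isCompact_empty, by simp, by simp, fun h' => absurd h' h⟩
  choose P hPc hPΩ hPj hPm using hpath
  obtain ⟨t, htK, htc⟩ := hK.elim_nhds_subcover (fun x => Metric.closedBall x (r x))
    fun x _ => Metric.closedBall_mem_nhds x (hr x)
  -- Finitely many discs cover `K`; paths are added between those centres that can be joined in `Ω`.
  set B : Set ℂ := ⋃ a ∈ t, Metric.closedBall a (r a) with hB
  set S : Set ℂ := ⋃ a ∈ t, ⋃ b ∈ t, P a b with hS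
  have hballL : ∀ a ∈ t, Metric.closedBall a (r a) ⊆ B ∪ S := fun a ha z hz =>
    Or.inl (Set.mem_iUnion₂.2 ⟨a, ha, hz⟩)
  have hPL : ∀ a ∈ t, ∀ b ∈ t, P a b ⊆ B ∪ S := fun a ha b hb z hz =>
    Or.inr (Set.mem_iUnion₂.2 ⟨a, ha, Set.mem_iUnion₂.2 ⟨b, hb, hz⟩⟩)
  have hLΩ : B ∪ S ⊆ Ω := by
    refine Set.union_subset (Set.iUnion₂_subset fun a ha => hrΩ a (hKΩ (htK a ha))) ?_
    exact Set.iUnion₂_subset fun a _ => Set.iUnion₂_subset fun b _ => hPΩ a b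
  have hcentre : ∀ x ∈ B ∪ S, ∃ a ∈ t, JoinedIn (B ∪ S) a x := by
    rintro x (hx | hx)
    · obtain ⟨a, ha, hxa⟩ := Set.mem_iUnion₂.1 hx
      refine ⟨a, ha, JoinedIn.mono ?_ (hballL a ha)⟩
      exact JoinedIn.of_segment_subset ((convex_closedBall a (r a)).segment_subset
        (Metric.mem_closedBall_self (hr a).le) hxa)
    · obtain ⟨a, ha, hx⟩ := Set.mem_iUnion₂.1 hx
      obtain ⟨b, hb, hx⟩ := Set.mem_iUnion₂.1 hx
      exact ⟨a, ha, (hPj a b x hx).mono (hPL a ha b hb)⟩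
  refine ⟨B ∪ S, ?_, fun x hx => Or.inl (htc hx), hLΩ, ?_⟩
  · refine IsCompact.union (t.isCompact_biUnion fun a _ => isCompact_closedBall a (r a)) ?_
    exact t.isCompact_biUnion fun a _ => t.isCompact_biUnion fun b _ => hPc a b
  · intro x hx y hy hxy
    obtain ⟨a, ha, hax⟩ := hcentre x hx
    obtain ⟨b, hb, hby⟩ := hcentre y hy
    have hab : JoinedIn Ω a b := ((hax.mono hLΩ).trans hxy).trans (hby.mono hLΩ).symm
    have : JoinedIn (B ∪ S) a b := (hPj a b b (hPm a b hab).2).mono (hPL a ha b hb)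
    exact (hax.symm.trans this).trans hby

/-! ### Unions of disjoint Arakelian sets -/

/-- The component of `p` leaves the compact set of points without logarithm, and having one is
constant along it because it avoids `A`. -/
lemma Escapes.hasLogSub {Ω : Set ℂ} (hΩ : HasConnectedSphereCompl Ω) {A G : Set Ω}
    (hA : IsCompact A) (hAG : A ⊆ G) {p : Ω} (hp : Escapes Gᶜ p) :
    HasLogSub ((↑) '' A) (p : ℂ) := by
  have hAc : IsCompact ((↑) '' A : Set ℂ) := hA.image continuous_subtype_val
  obtain ⟨hBc, hBΩ⟩ := isCompact_setOf_not_hasLogSub hΩ hAc (by rintro _ ⟨a, -, rfl⟩; exact a.2)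
  have hQ : IsCompact ((↑) ⁻¹' ((↑) '' A ∪ {p | p ∉ ((↑) '' A : Set ℂ) ∧
      ¬ HasLogSub ((↑) '' A) p}) : Set Ω) :=
    IsInducing.subtypeVal.isCompact_preimage' hBc (by simpa using hBΩ)
  obtain ⟨q, hq, hqB⟩ := Set.not_subset.1 (hp _ hQ)
  simp only [Set.mem_preimage, Set.mem_union, Set.mem_ofPred_eq, not_or, not_and, not_not] at hqB
  have hpG : p ∈ Gᶜ := by
    by_contra h
    rw [connectedComponentIn_eq_empty h] at hq
    exact hq
  refine HasLogSub.of_isPreconnected hAc.isClosed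
    (T := (↑) '' connectedComponentIn Gᶜ p)
    (isPreconnected_connectedComponentIn.image _ continuous_subtype_val.continuousOn)
    ?_ ⟨p, mem_connectedComponentIn hpG, rfl⟩ ⟨q, hq, rfl⟩ (hqB.2 hqB.1)
  rintro _ ⟨z, hz, rfl⟩ ⟨a, ha, haz⟩
  exact connectedComponentIn_subset _ _ hz (Subtype.ext haz ▸ hAG ha)

lemma Escapes.union {Ω : Set ℂ} (hΩo : IsOpen Ω) (hΩ : HasConnectedSphereCompl Ω)
    {F₁ F₂ K : Set Ω} (hF₁ : IsClosed F₁) (hF₂ : IsClosed F₂) (hdisj : Disjoint F₁ F₂)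
    (hK : IsCompact K)
    (hKj : ∀ x ∈ K, ∀ y ∈ K, JoinedIn Ω (x : ℂ) y → JoinedIn ((↑) '' K) (x : ℂ) y) {p : Ω}
    (hp : p ∉ F₁ ∪ F₂ ∪ K) (h₁ : Escapes (F₁ ∪ K)ᶜ p) (h₂ : Escapes (F₂ ∪ K)ᶜ p) :
    Escapes (F₁ ∪ F₂ ∪ K)ᶜ p := by
  classical
  intro Q hQ hCQ
  have : LocallyConnectedSpace Ω := hΩo.locallyConnectedSpace
  have : LocallyPathConnectedSpace Ω := hΩo.locallyPathConnectedSpace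
  have hU : IsOpen (F₁ ∪ F₂ ∪ K)ᶜ := ((hF₁.union hF₂).union hK.isClosed).isOpen_compl
  set C := connectedComponentIn (F₁ ∪ F₂ ∪ K)ᶜ p with hC
  have hpC : p ∈ C := mem_connectedComponentIn hp
  have hCo : IsOpen ((↑) '' C : Set ℂ) := hΩo.isOpenMap_subtype_val _ hU.connectedComponentIn
  set D := closure C with hDdef
  have hD : IsCompact D :=
    hQ.of_isClosed_subset isClosed_closure (closure_minimal hCQ hQ.isClosed)
  have hD' : IsCompact ((↑) '' D : Set ℂ) := hD.image continuous_subtype_val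
  have hCb : Bornology.IsBounded ((↑) '' C : Set ℂ) :=
    hD'.isBounded.subset (Set.image_mono subset_closure)
  have hfr : frontier ((↑) '' C : Set ℂ) ⊆ (↑) '' ((F₁ ∪ K) ∩ D) ∪ (↑) '' ((F₂ ∪ K) ∩ D) := by
    intro z hz
    rw [hCo.frontier_eq] at hz
    obtain ⟨d, hd, rfl⟩ := closure_minimal (Set.image_mono subset_closure) hD'.isClosed hz.1
    have hdC : d ∉ C := fun h => hz.2 ⟨d, h, rfl⟩
    have hdU : d ∈ F₁ ∪ F₂ ∪ K := by
      by_contra h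
      exact hdC (mem_connectedComponentIn_of_mem_closure hU h hd)
    rcases hdU with (h | h) | h
    · exact Or.inl ⟨d, ⟨Or.inl h, hd⟩, rfl⟩
    · exact Or.inr ⟨d, ⟨Or.inl h, hd⟩, rfl⟩
    · exact Or.inl ⟨d, ⟨Or.inr h, hd⟩, rfl⟩
  have hcomp : ∀ F : Set Ω, IsClosed F → IsCompact (F ∩ D ∪ K) := fun F hF =>
    (hD.inter_left hF).union hK
  obtain ⟨g₁, hg₁, he₁⟩ := h₁.hasLogSub hΩ (hcomp F₁ hF₁)
    (Set.union_subset_union_left _ Set.inter_subset_left)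
  obtain ⟨g₂, hg₂, he₂⟩ := h₂.hasLogSub hΩ (hcomp F₂ hF₂)
    (Set.union_subset_union_left _ Set.inter_subset_left)
  -- Both points lie in the closure of the connected `C`, hence in one component of `Ω`, so `hKj`
  -- joins them inside `K`, where both logarithms are defined.
  have hKD : ∀ x ∈ K ∩ D, ∀ y ∈ K ∩ D, g₁ x - g₂ x = g₁ y - g₂ y := by
    intro x hx y hy
    have hxy : JoinedIn Ω (x : ℂ) y := by
      rw [joinedIn_iff_joined x.2 y.2]
      have : y ∈ connectedComponent x :=
        isPreconnected_connectedComponentIn.closure.subset_connectedComponent hx.2 hy.2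
      rwa [← pathComponent_eq_connectedComponent] at this
    have hj := hKj x hx.1 y hy.1 hxy
    have hT : Set.range hj.somePath ⊆ (↑) '' K := by
      rintro _ ⟨t, rfl⟩
      exact hj.somePath_mem t
    have hTK : ∀ F : Set Ω, Set.range hj.somePath ⊆ (↑) '' (F ∩ D ∪ K) := fun F =>
      hT.trans (Set.image_mono Set.subset_union_right)
    refine eq_of_isPreconnected_of_exp_eq_one (h := fun z => g₁ z - g₂ z)
      (isPreconnected_range hj.somePath.continuous)
      ((hg₁.mono (hTK F₁)).sub (hg₂.mono (hTK F₂))) (fun z hz => ?_)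
      ⟨0, hj.somePath.source⟩ ⟨1, hj.somePath.target⟩
    have e₁ := he₁ z (hTK F₁ hz)
    rw [Complex.exp_sub, e₁, he₂ z (hTK F₂ hz)]
    exact div_self (e₁ ▸ Complex.exp_ne_zero _)
  obtain ⟨c, hc, hcK⟩ : ∃ c : ℂ, Complex.exp c = 1 ∧ ∀ x ∈ K ∩ D, g₁ x = g₂ x + c := by
    rcases (K ∩ D).eq_empty_or_nonempty with h | ⟨x, hx⟩
    · exact ⟨0, by simp, by simp [h]⟩
    · refine ⟨g₁ x - g₂ x, ?_, fun y hy => by rw [hKD x hx y hy]; ring⟩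
      have e₁ := he₁ x ⟨x, Or.inr hx.1, rfl⟩
      rw [Complex.exp_sub, e₁, he₂ x ⟨x, Or.inr hx.1, rfl⟩]
      exact div_self (e₁ ▸ Complex.exp_ne_zero _)
  set A₁ : Set ℂ := (↑) '' ((F₁ ∪ K) ∩ D) with hA₁
  set A₂ : Set ℂ := (↑) '' ((F₂ ∪ K) ∩ D) with hA₂
  have hsub : ∀ F : Set Ω, ((↑) '' ((F ∪ K) ∩ D) : Set ℂ) ⊆ (↑) '' (F ∩ D ∪ K) := fun F =>
    Set.image_mono fun z hz => hz.1.imp (⟨·, hz.2⟩) id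
  have hclosed : ∀ F : Set Ω, IsClosed F → IsClosed ((↑) '' ((F ∪ K) ∩ D) : Set ℂ) := fun F hF =>
    ((hD.inter_left (hF.union hK.isClosed)).image continuous_subtype_val).isClosed
  -- By disjointness `A₁` and `A₂` overlap only in `K ∩ D`, where the shift by `c` makes the two
  -- branches agree.
  set g : ℂ → ℂ := fun z => if z ∈ A₁ then g₁ z else g₂ z + c with hg
  have heq₁ : ∀ z ∈ A₁, g z = g₁ z := fun z hz => if_pos hz
  have heq₂ : ∀ z ∈ A₂, g z = g₂ z + c := by
    rintro _ ⟨x, hx, rfl⟩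
    by_cases hxA : (x : ℂ) ∈ A₁
    · rw [heq₁ _ hxA]
      obtain ⟨y, hy, hyx⟩ := hxA
      rw [Subtype.ext hyx] at hy
      refine hcK x ⟨?_, hx.2⟩
      rcases hx.1 with h2 | h
      · rcases hy.1 with h1 | h
        · exact absurd h2 (Set.disjoint_left.1 hdisj h1)
        · exact h
      · exact h
    · exact if_neg hxA
  refine not_hasLogSub_frontier hCb ⟨p, hpC, rfl⟩ (HasLogSub.mono ⟨g, ?_, ?_⟩ hfr)
  · refine ContinuousOn.union_of_isClosed ?_ ?_ (hclosed F₁ hF₁) (hclosed F₂ hF₂)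
    · exact (hg₁.mono (hsub F₁)).congr heq₁
    · exact ((hg₂.mono (hsub F₂)).add continuousOn_const).congr heq₂
  · rintro z (hz | hz)
    · rw [heq₁ z hz, he₁ z (hsub F₁ hz)]
    · rw [heq₂ z hz, Complex.exp_add, hc, mul_one, he₂ z (hsub F₂ hz)]

lemma IsArakelian.union {Ω F₁ F₂ : Set ℂ} (hΩo : IsOpen Ω) (hΩ : HasConnectedSphereCompl Ω)
    (h₁ : IsArakelian Ω F₁) (h₂ : IsArakelian Ω F₂) (hdisj : Disjoint F₁ F₂) :
    IsArakelian Ω (F₁ ∪ F₂) := by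
  rw [isArakelian_iff hΩo] at *
  obtain ⟨hs₁, hc₁, he₁, hl₁⟩ := h₁
  obtain ⟨hs₂, hc₂, he₂, hl₂⟩ := h₂
  have hd : Disjoint ((↑) ⁻¹' F₁ : Set Ω) ((↑) ⁻¹' F₂) := hdisj.preimage _
  rw [Set.preimage_union]
  refine ⟨Set.union_subset hs₁ hs₂, hc₁.union hc₂, fun p hp => ?_, fun K hK => ?_⟩
  · have := Escapes.union hΩo hΩ hc₁ hc₂ hd isCompact_empty (by simp) (p := p)
      (by simpa using hp) (by simpa using he₁ p fun h => hp (Or.inl h))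
      (by simpa using he₂ p fun h => hp (Or.inr h))
    simpa using this
  -- `K` need not satisfy the joining hypothesis of `Escapes.union`, but a larger `L` does, and
  -- escaping off `L` implies escaping off `K`.
  · obtain ⟨L, hL, hKL, hLΩ, hLj⟩ := exists_isCompact_joinedIn hΩo
      (hK.image continuous_subtype_val) (by rintro _ ⟨a, -, rfl⟩; exact a.2)
    have hLc : IsCompact ((↑) ⁻¹' L : Set Ω) :=
      IsInducing.subtypeVal.isCompact_preimage' hL (by simpa using hLΩ)
    have hLL : ((↑) '' ((↑) ⁻¹' L : Set Ω) : Set ℂ) = L := by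
      rw [Subtype.image_preimage_coe, Set.inter_eq_right.2 hLΩ]
    obtain ⟨Q₁, hQ₁, hE₁⟩ := hl₁ _ hLc
    obtain ⟨Q₂, hQ₂, hE₂⟩ := hl₂ _ hLc
    refine ⟨(↑) ⁻¹' L ∪ (Q₁ ∪ Q₂), hLc.union (hQ₁.union hQ₂), fun p hp => ?_⟩
    simp only [Set.mem_union, not_or] at hp
    have hU := Escapes.union hΩo hΩ hc₁ hc₂ hd hLc
      (fun x hx y hy => by rw [hLL]; exact hLj x hx y hy) (p := p)
      (by simp only [Set.mem_union]; tauto)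
      (hE₁ p (by simp only [Set.mem_union]; tauto)) (hE₂ p (by simp only [Set.mem_union]; tauto))
    refine hU.mono (Set.compl_subset_compl.2 (Set.union_subset_union_right _ ?_))
    exact fun x hx => hKL ⟨x, hx, rfl⟩

section PuncturedDisk

/-! ### The punctured disk -/

lemma mem_puncturedDisk {z : ℂ} : z ∈ Metric.ball (0 : ℂ) 1 \ {0} ↔ ‖z‖ < 1 ∧ 0 < ‖z‖ := by
  simp

lemma isOpen_puncturedDisk : IsOpen (Metric.ball (0 : ℂ) 1 \ {0}) :=
  Metric.isOpen_ball.sdiff isClosed_singleton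

lemma not_hasConnectedSphereCompl_puncturedDisk :
    ¬ HasConnectedSphereCompl (Metric.ball (0 : ℂ) 1 \ {0}) := by
  intro h
  obtain ⟨x, hx, ⟨z, hz, rfl⟩, hx2⟩ := h.isPreconnected ((↑) '' Metric.ball (0 : ℂ) (1 / 2))
    ((↑) '' Metric.closedBall (0 : ℂ) (1 / 2))ᶜ
    (OnePoint.isOpen_image_coe.2 Metric.isOpen_ball)
    (OnePoint.isOpen_compl_image_coe.2 ⟨Metric.isClosed_closedBall, isCompact_closedBall _ _⟩)
    (by
      intro x hx
      induction x using OnePoint.rec with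
      | infty => exact Or.inr (infty_mem_compl_image_coe _)
      | coe z =>
        have hz : z ∉ Metric.ball (0 : ℂ) 1 \ {0} := fun h => hx ⟨z, h, rfl⟩
        rw [mem_puncturedDisk, not_and, not_lt] at hz
        by_cases h1 : ‖z‖ < 1
        · exact Or.inl ⟨z, by simpa using (hz h1).trans_lt (by norm_num), rfl⟩
        · right
          rintro ⟨w, hw, hwz⟩
          rw [OnePoint.coe_injective hwz, mem_closedBall_zero_iff] at hw
          linarith)
    ⟨((0 : ℂ) : OnePoint ℂ), by simp, 0, by simp, rfl⟩
    ⟨OnePoint.infty, infty_mem_compl_image_coe _, infty_mem_compl_image_coe _⟩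
  exact hx2 (Set.image_mono Metric.ball_subset_closedBall ⟨z, hz, rfl⟩)

/-- Along a radius of the punctured disk one leaves every compact set. -/
lemma escapes_of_radius {K : Set ↥(Metric.ball (0 : ℂ) 1 \ {0})}
    {p : ↥(Metric.ball (0 : ℂ) 1 \ {0})} {I : Set ℝ} (hI : IsPreconnected I)
    (hIp : ‖(p : ℂ)‖ ∈ I) (hIΩ : I ⊆ Set.Ioo 0 1) (hIK : ∀ z ∈ K, ‖(z : ℂ)‖ ∉ I)
    (hIc : ∀ m > 0, ∀ M < 1, ¬ I ⊆ Set.Icc m M) : Escapes Kᶜ p := by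
  intro Q hQ hsub
  have hp := mem_puncturedDisk.1 p.2
  have hnorm : ∀ t ∈ I, ‖((t / ‖(p : ℂ)‖ : ℝ) : ℂ) * p‖ = t := by
    intro t ht
    rw [norm_mul, Complex.norm_real, Real.norm_of_nonneg (div_pos (hIΩ ht).1 hp.2).le,
      div_mul_cancel₀ _ hp.2.ne']
  have hmem : ∀ t ∈ I, ((t / ‖(p : ℂ)‖ : ℝ) : ℂ) * p ∈ Metric.ball (0 : ℂ) 1 \ {0} := by
    intro t ht
    rw [mem_puncturedDisk, hnorm t ht]
    exact ⟨(hIΩ ht).2, (hIΩ ht).1⟩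
  set T : Set ↥(Metric.ball (0 : ℂ) 1 \ {0}) :=
    Set.range fun t : I => ⟨((t / ‖(p : ℂ)‖ : ℝ) : ℂ) * p, hmem t t.2⟩ with hT
  have hTc : IsPreconnected T := by
    have : PreconnectedSpace I := isPreconnected_iff_preconnectedSpace.1 hI
    exact isPreconnected_range (by fun_prop)
  have hTp : p ∈ T := by
    refine ⟨⟨_, hIp⟩, Subtype.ext ?_⟩
    simp [div_self hp.2.ne']
  have hTK : T ⊆ Kᶜ := by
    rintro _ ⟨t, rfl⟩ ht
    refine hIK _ ht ?_
    simp only [hnorm t t.2]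
    exact t.2
  have hTQ : T ⊆ Q := (hTc.subset_connectedComponentIn hTp hTK).trans hsub
  have hcont : Continuous fun z : ↥(Metric.ball (0 : ℂ) 1 \ {0}) => ‖(z : ℂ)‖ := by fun_prop
  obtain ⟨a, -, ha⟩ := hQ.exists_isMinOn ⟨p, hTQ hTp⟩ hcont.continuousOn
  obtain ⟨b, -, hb⟩ := hQ.exists_isMaxOn ⟨p, hTQ hTp⟩ hcont.continuousOn
  refine hIc _ (mem_puncturedDisk.1 a.2).2 _ (mem_puncturedDisk.1 b.2).1 fun t ht => ?_
  have htQ := hTQ ⟨⟨t, ht⟩, rfl⟩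
  have h1 := ha htQ
  have h2 := hb htQ
  simp only [Set.mem_ofPred_eq, hnorm t ht] at h1 h2
  exact ⟨h1, h2⟩

lemma escapes_of_norm_lt {K : Set ↥(Metric.ball (0 : ℂ) 1 \ {0})}
    {p : ↥(Metric.ball (0 : ℂ) 1 \ {0})} (h : ∀ z ∈ K, ‖(p : ℂ)‖ < ‖(z : ℂ)‖) :
    Escapes Kᶜ p := by
  have hp := mem_puncturedDisk.1 p.2
  refine escapes_of_radius (I := Set.Ioc 0 ‖(p : ℂ)‖) isPreconnected_Ioc ⟨hp.2, le_rfl⟩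
    (fun t ht => ⟨ht.1, ht.2.trans_lt hp.1⟩) (fun z hz hzI => (h z hz).not_ge hzI.2) ?_
  intro m hm M hM hsub
  have h1 : min (m / 2) ‖(p : ℂ)‖ ∈ Set.Ioc 0 ‖(p : ℂ)‖ :=
    ⟨lt_min (by linarith) hp.2, min_le_right _ _⟩
  have := (hsub h1).1.trans (min_le_left _ _)
  linarith

lemma escapes_of_lt_norm {K : Set ↥(Metric.ball (0 : ℂ) 1 \ {0})}
    {p : ↥(Metric.ball (0 : ℂ) 1 \ {0})} (h : ∀ z ∈ K, ‖(z : ℂ)‖ < ‖(p : ℂ)‖) :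
    Escapes Kᶜ p := by
  have hp := mem_puncturedDisk.1 p.2
  refine escapes_of_radius (I := Set.Ico ‖(p : ℂ)‖ 1) isPreconnected_Ico ⟨le_rfl, hp.1⟩
    (fun t ht => ⟨hp.2.trans_le ht.1, ht.2⟩) (fun z hz hzI => (h z hz).not_ge hzI.1) ?_
  intro m hm M hM hsub
  have h1 : max ((M + 1) / 2) ‖(p : ℂ)‖ ∈ Set.Ico ‖(p : ℂ)‖ 1 :=
    ⟨le_max_right _ _, max_lt (by linarith) hp.1⟩
  have := (le_max_left _ _).trans (hsub h1).2
  linarith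

lemma isCompact_preimage_norm {m M : ℝ} (hm : 0 < m) (hM : M < 1) :
    IsCompact ((fun z : ↥(Metric.ball (0 : ℂ) 1 \ {0}) => ‖(z : ℂ)‖) ⁻¹' Set.Icc m M) := by
  have hc : IsCompact ((fun z : ℂ => ‖z‖) ⁻¹' Set.Icc m M) := by
    refine Metric.isCompact_of_isClosed_isBounded (isClosed_Icc.preimage continuous_norm)
      ((Metric.isBounded_closedBall (x := (0 : ℂ)) (r := M)).subset fun z hz => ?_)
    rw [mem_closedBall_zero_iff]
    exact hz.2
  refine IsInducing.subtypeVal.isCompact_preimage' hc ?_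
  rw [Subtype.range_coe]
  exact fun z hz => mem_puncturedDisk.2 ⟨hz.2.trans_lt hM, hm.trans_le hz.1⟩

lemma isArakelian_sphere_puncturedDisk {r : ℝ} (h0 : 0 < r) (h1 : r < 1) :
    IsArakelian (Metric.ball (0 : ℂ) 1 \ {0}) (Metric.sphere (0 : ℂ) r) := by
  rw [isArakelian_iff isOpen_puncturedDisk]
  have hS : Metric.sphere (0 : ℂ) r ⊆ Metric.ball (0 : ℂ) 1 \ {0} := by
    intro z hz
    rw [mem_sphere_zero_iff_norm] at hz
    rw [mem_puncturedDisk, hz]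
    exact ⟨h1, h0⟩
  have hSc : IsCompact ((↑) ⁻¹' Metric.sphere (0 : ℂ) r : Set ↥(Metric.ball (0 : ℂ) 1 \ {0})) :=
    IsInducing.subtypeVal.isCompact_preimage' (isCompact_sphere _ _) (by rwa [Subtype.range_coe])
  refine ⟨hS, hSc.isClosed, fun p hp => ?_, fun K hK => ?_⟩
  · have hpr : ‖(p : ℂ)‖ ≠ r := by simpa using hp
    rcases hpr.lt_or_gt with h | h
    · refine escapes_of_norm_lt fun z hz => ?_
      rwa [mem_sphere_zero_iff_norm.1 hz]
    · refine escapes_of_lt_norm fun z hz => ?_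
      rwa [mem_sphere_zero_iff_norm.1 hz]
  · set G : Set ↥(Metric.ball (0 : ℂ) 1 \ {0}) := (↑) ⁻¹' Metric.sphere (0 : ℂ) r ∪ K with hG
    have hGc : IsCompact G := hSc.union hK
    have hr : ((r : ℝ) : ℂ) ∈ Metric.sphere (0 : ℂ) r := by simp [abs_of_pos h0]
    have hGne : G.Nonempty := ⟨⟨r, hS hr⟩, Or.inl hr⟩
    have hcont : Continuous fun z : ↥(Metric.ball (0 : ℂ) 1 \ {0}) => ‖(z : ℂ)‖ := by fun_prop
    obtain ⟨a, -, ha⟩ := hGc.exists_isMinOn hGne hcont.continuousOn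
    obtain ⟨b, -, hb⟩ := hGc.exists_isMaxOn hGne hcont.continuousOn
    -- `Q` is the closed annulus spanned by `G`: a point off it is nearer to 0, or farther from 0,
    -- than all of `G`.
    refine ⟨_, isCompact_preimage_norm (mem_puncturedDisk.1 a.2).2 (mem_puncturedDisk.1 b.2).1,
      fun p hp => ?_⟩
    have hpQ : ¬ (‖(a : ℂ)‖ ≤ ‖(p : ℂ)‖ ∧ ‖(p : ℂ)‖ ≤ ‖(b : ℂ)‖) := fun h => hp (Or.inr h)
    by_cases hap : ‖(a : ℂ)‖ ≤ ‖(p : ℂ)‖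
    · have hbp : ‖(b : ℂ)‖ < ‖(p : ℂ)‖ := not_le.1 fun h => hpQ ⟨hap, h⟩
      exact escapes_of_lt_norm fun z hz => (hb hz).trans_lt hbp
    · exact escapes_of_norm_lt fun z hz => (not_le.1 hap).trans_le (ha hz)

/-- Connectedness already fails: by the intermediate value property of the norm, the component of a
point between the circles stays in the compact closed annulus. -/
lemma not_isArakelian_union_spheres {r₁ r₂ : ℝ} (h0 : 0 < r₁) (h12 : r₁ < r₂) (h1 : r₂ < 1) :
    ¬ IsArakelian (Metric.ball (0 : ℂ) 1 \ {0})
      (Metric.sphere (0 : ℂ) r₁ ∪ Metric.sphere (0 : ℂ) r₂) := by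
  rw [isArakelian_iff isOpen_puncturedDisk]
  rintro ⟨-, -, h, -⟩
  have hs0 : 0 < (r₁ + r₂) / 2 := by linarith
  have hn : ‖(((r₁ + r₂) / 2 : ℝ) : ℂ)‖ = (r₁ + r₂) / 2 := by
    rw [Complex.norm_real, Real.norm_of_nonneg hs0.le]
  have hmem : (((r₁ + r₂) / 2 : ℝ) : ℂ) ∈ Metric.ball (0 : ℂ) 1 \ {0} := by
    rw [mem_puncturedDisk, hn]
    constructor <;> linarith
  set p : ↥(Metric.ball (0 : ℂ) 1 \ {0}) := ⟨_, hmem⟩ with hp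
  have hpn : ‖(p : ℂ)‖ = (r₁ + r₂) / 2 := hn
  have hpF : p ∉ ((↑) ⁻¹' (Metric.sphere (0 : ℂ) r₁ ∪ Metric.sphere (0 : ℂ) r₂) :
      Set ↥(Metric.ball (0 : ℂ) 1 \ {0})) := by
    rw [Set.mem_preimage, Set.mem_union, mem_sphere_zero_iff_norm, mem_sphere_zero_iff_norm, hpn]
    rintro (h | h) <;> linarith
  refine h p hpF _ (isCompact_preimage_norm h0 h1) fun q hq => ?_
  set C := connectedComponentIn ((↑) ⁻¹' (Metric.sphere (0 : ℂ) r₁ ∪ Metric.sphere (0 : ℂ) r₂) :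
    Set ↥(Metric.ball (0 : ℂ) 1 \ {0}))ᶜ p with hC
  have hord : ((fun z : ↥(Metric.ball (0 : ℂ) 1 \ {0}) => ‖(z : ℂ)‖) '' C).OrdConnected :=
    (isPreconnected_connectedComponentIn.image _
      (by fun_prop : Continuous fun z : ↥(Metric.ball (0 : ℂ) 1 \ {0}) =>
        ‖(z : ℂ)‖).continuousOn).ordConnected
  have hpC : (r₁ + r₂) / 2 ∈ (fun z : ↥(Metric.ball (0 : ℂ) 1 \ {0}) => ‖(z : ℂ)‖) '' C :=
    ⟨p, mem_connectedComponentIn hpF, hpn⟩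
  have hqC : ‖(q : ℂ)‖ ∈ (fun z : ↥(Metric.ball (0 : ℂ) 1 \ {0}) => ‖(z : ℂ)‖) '' C :=
    ⟨q, hq, rfl⟩
  by_contra hqI
  rw [Set.mem_preimage, Set.mem_Icc, not_and_or, not_le, not_le] at hqI
  rcases hqI with hlt | hlt
  · obtain ⟨z, hz, hzr⟩ := hord.out hqC hpC ⟨hlt.le, by linarith⟩
    exact connectedComponentIn_subset _ _ hz (Or.inl (mem_sphere_zero_iff_norm.2 hzr))
  · obtain ⟨z, hz, hzr⟩ := hord.out hpC hqC ⟨by linarith, hlt.le⟩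
    exact connectedComponentIn_subset _ _ hz (Or.inr (mem_sphere_zero_iff_norm.2 hzr))

end PuncturedDisk

theorem corollary2p9 :
    (∀ Ω : Set ℂ, IsOpen Ω → HasConnectedSphereCompl Ω →
      ∀ F₁ F₂ : Set ℂ, IsArakelian Ω F₁ → IsArakelian Ω F₂ → Disjoint F₁ F₂ →
        IsArakelian Ω (F₁ ∪ F₂)) ∧
    (∀ Ω : Set ℂ, Ω = Metric.ball (0 : ℂ) 1 \ {0} →
      IsOpen Ω ∧ ¬ HasConnectedSphereCompl Ω ∧
      ∀ r₁ r₂ : ℝ, 0 < r₁ → r₁ < r₂ → r₂ < 1 →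
        IsArakelian Ω (Metric.sphere (0 : ℂ) r₁) ∧
        IsArakelian Ω (Metric.sphere (0 : ℂ) r₂) ∧
        Disjoint (Metric.sphere (0 : ℂ) r₁) (Metric.sphere (0 : ℂ) r₂) ∧
        ¬ IsArakelian Ω (Metric.sphere (0 : ℂ) r₁ ∪ Metric.sphere (0 : ℂ) r₂)) := by
  refine ⟨fun Ω hΩo hΩ F₁ F₂ h₁ h₂ hd => h₁.union hΩo hΩ h₂ hd, ?_⟩
  rintro _ rfl
  refine ⟨isOpen_puncturedDisk, not_hasConnectedSphereCompl_puncturedDisk,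
    fun r₁ r₂ h0 h12 h1 => ⟨isArakelian_sphere_puncturedDisk h0 (h12.trans h1),
      isArakelian_sphere_puncturedDisk (h0.trans h12) h1, ?_,
      not_isArakelian_union_spheres h0 h12 h1⟩⟩
  rw [Set.disjoint_left]
  intro z hz₁ hz₂
  rw [mem_sphere_zero_iff_norm] at hz₁ hz₂
  exact h12.ne (hz₁.symm.trans hz₂)
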